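/- Let $A,B\in M_2(\mathbb C)$ and suppose that $A$ has real eigenvalues $\lambda_1>0>\lambda_2$. Consider the system $$\frac{d}{dx}\begin{pmatrix} f\\ g\end{pmatrix}=(Ax+B)\begin{pmatrix} f\\ g\end{pmatrix},\qquad f,g:\mathbb R\to\mathbb C. \qquad (*)$$ (a) Suppose that no eigenvector of $A$ for $\lambda_2$ is an eigenvector of $B$. Let $P\in GL(2,\mathbb C)$ be any matrix such that $PAP^{-1}$ is diagonal and write $PBP^{-1}=\begin{pmatrix} b_1&b_2\\ b_3&b_4\end{pmatrix}$. Then $(*)$ has a solution $(f,g)\neq(0,0)$ with $f,g\in L^2(\mathbb R)$ if and only if $b_2b_3=(\lambda_1-\lambda_2)\,n$ for some integer $n<0$. (b) If some eigenvector of $A$ for $\lambda_2$ is also an eigenvector of $B$ (equivalently, $b_2=0$ when $PAP^{-1}=\mathrm{diag}(\lambda_1,\lambda_2)$), then $(*)$ has a solution $(f,g)\neq(0,0)$ with $f,g\in L^2(\mathbb R)$. (c) For every solution $(f,g)$ of $(*)$ with $f,g\in L^2(\mathbb R)$, both $f$ and $g$ are Schwartz functions. -/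

import Mathlib

open MeasureTheory

/-- `(f, g)` is a solution on the whole real line of `(f, g)' = (A x + B) (f, g)`. -/
def IsSolution (A B : Matrix (Fin 2) (Fin 2) ℂ) (f g : ℝ → ℂ) : Prop :=
  ∀ x : ℝ, HasDerivAt (fun t : ℝ => ![f t, g t])
    (((x : ℂ) • A + B).mulVec ![f x, g x]) x

/-- `(f, g)` is a solution with both components in `L²(ℝ)`. -/
def IsL2Solution (A B : Matrix (Fin 2) (Fin 2) ℂ) (f g : ℝ → ℂ) : Prop :=
  IsSolution A B f g ∧ MemLp f 2 volume ∧ MemLp g 2 volume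

/-- The system has a pair of square-integrable solutions `f, g`, not both zero. -/
def HasNonzeroL2Solution (A B : Matrix (Fin 2) (Fin 2) ℂ) : Prop :=
  ∃ f g : ℝ → ℂ, IsL2Solution A B f g ∧ (f ≠ 0 ∨ g ≠ 0)

/-- `h` is (the underlying function of) a Schwartz function. -/
def IsSchwartz (h : ℝ → ℂ) : Prop :=
  ∃ F : SchwartzMap ℝ ℂ, ∀ x, F x = h x

/-- Some eigenvector of `A` for the eigenvalue `l` is also an eigenvector of `B`.
If `P A P⁻¹ = diag (l₁, l)` with `l₁ ≠ l`, this says that the upper right entry of `P B P⁻¹`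
is zero. -/
def SharesEigenvector (A B : Matrix (Fin 2) (Fin 2) ℂ) (l : ℂ) : Prop :=
  ∃ (v : Fin 2 → ℂ) (m : ℂ), Module.End.HasEigenvector (Matrix.toLin' A) l v ∧
    Module.End.HasEigenvector (Matrix.toLin' B) m v

/-! ### Gaussian bounds -/

/-! Conjugation by `P` turns the system into `u' = (l₁x + b₁)u + b₂v`, `v' = b₃u + (l₂x + b₄)v`. Put
`d = l₁ - l₂`.

Existence: removing the Gaussian `exp(l₂x²/2 + b₄x)` leaves a Hermite equation for the `v`
component, with a polynomial solution when `b₂b₃ = -dm` (`exists_isDiagSolution_of_eq`). A shared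
eigenvector instead gives a pure Gaussian solution.

Necessity: after multiplication by `exp(-l₁x²/2 - b₁x)`, an L² solution has all exponential moments.
Integrating derivatives of `xᵏp` and `xᵏy` over the line yields `(b₂b₃ + d(k+1)) ∫ xᵏp = 0` once the
lower moments of `p` vanish. If no factor vanishes, all moments of `p` vanish, hence its Fourier
transform and `p` itself (`eq_zero_of_isDiagSolution`).

Schwartz decay: for large `x` the quantity `|u|² - |v|²` is nondecreasing, so square-integrability
forces `|u| ≤ |v|`, and there `v` decays exponentially (`IsDiagSolution.exists_exp_bound_atTop`).
Derivatives of solutions are polynomial combinations of `f` and `g`, so exponential decay suffices.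
-/

lemma integrable_exp_neg_mul_sq_add_mul_abs {a : ℝ} (ha : 0 < a) (c : ℝ) :
    Integrable (fun x : ℝ => Real.exp (-a * x ^ 2 + c * |x|)) := by
  have h := (integrable_exp_neg_mul_sq (half_pos ha)).mul_const (Real.exp (c ^ 2 / (2 * a)))
  refine h.mono' (by fun_prop) (Filter.Eventually.of_forall fun x => ?_)
  rw [Real.norm_of_nonneg (Real.exp_pos _).le, ← Real.exp_add, Real.exp_le_exp]
  -- Completing the square: half of the quadratic term absorbs the linear one.
  have h1 : c ^ 2 / (2 * a) + -(a / 2) * x ^ 2 - (-a * x ^ 2 + c * |x|)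
      = (c - a * |x|) ^ 2 / (2 * a) := by
    rw [← sq_abs x]; field_simp; ring
  have h2 : 0 ≤ (c - a * |x|) ^ 2 / (2 * a) := by positivity
  linarith

lemma memLp_exp_neg_mul_sq_add_mul_abs {a : ℝ} (ha : 0 < a) (c : ℝ) :
    MemLp (fun x : ℝ => Real.exp (-a * x ^ 2 + c * |x|)) 2 volume := by
  rw [memLp_two_iff_integrable_sq (by fun_prop)]
  convert integrable_exp_neg_mul_sq_add_mul_abs (mul_pos two_pos ha) (2 * c) using 2 with x
  rw [← Real.exp_nat_mul]
  push_cast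
  ring_nf

lemma norm_cexp_quadratic_le (l : ℝ) (b : ℂ) (x : ℝ) :
    ‖Complex.exp ((l : ℂ) * x ^ 2 / 2 + b * x)‖ ≤ Real.exp (l / 2 * x ^ 2 + ‖b‖ * |x|) := by
  rw [Complex.norm_exp, Real.exp_le_exp]
  have h1 : ((l : ℂ) * x ^ 2 / 2 + b * x).re = l / 2 * x ^ 2 + (b * x).re := by
    have : (l : ℂ) * x ^ 2 / 2 = ((l / 2 * x ^ 2 : ℝ) : ℂ) := by push_cast; ring
    rw [this, Complex.add_re, Complex.ofReal_re]
  have h2 := Complex.re_le_norm (b * x)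
  rw [norm_mul, Complex.norm_real, Real.norm_eq_abs] at h2
  linarith

lemma hasDerivAt_cexp_quadratic (l b : ℂ) (x : ℝ) :
    HasDerivAt (fun t : ℝ => Complex.exp (l * t ^ 2 / 2 + b * t))
      ((l * x + b) * Complex.exp (l * x ^ 2 / 2 + b * x)) x := by
  have hx : HasDerivAt (fun t : ℝ => (t : ℂ)) 1 x := Complex.ofRealCLM.hasDerivAt
  have h := ((((hx.pow 2).const_mul l).div_const 2).add (hx.const_mul b)).cexp
  refine h.congr_deriv ?_
  simp
  ring

lemma norm_pow_le_exp_abs (k : ℕ) (x : ℝ) : |x| ^ k ≤ k.factorial * Real.exp |x| := by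
  have := Real.pow_div_factorial_le_exp |x| (abs_nonneg x) k
  rwa [div_le_iff₀ (by positivity), mul_comm] at this

lemma exists_norm_eval_le_exp_abs (p : Polynomial ℂ) :
    ∃ C : ℝ, ∀ x : ℝ, ‖p.eval (x : ℂ)‖ ≤ C * Real.exp |x| := by
  induction p using Polynomial.induction_on' with
  | add p q hp hq =>
    obtain ⟨C, hC⟩ := hp
    obtain ⟨D, hD⟩ := hq
    refine ⟨C + D, fun x => ?_⟩
    rw [Polynomial.eval_add, add_mul]
    exact (norm_add_le _ _).trans (add_le_add (hC x) (hD x))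
  | monomial n a =>
    refine ⟨‖a‖ * n.factorial, fun x => ?_⟩
    rw [Polynomial.eval_monomial, norm_mul, norm_pow, Complex.norm_real, Real.norm_eq_abs,
      mul_assoc]
    exact mul_le_mul_of_nonneg_left (norm_pow_le_exp_abs n x) (norm_nonneg a)

lemma memLp_eval_mul_cexp_quadratic {l : ℝ} (hl : l < 0) (b : ℂ) (p : Polynomial ℂ) :
    MemLp (fun x : ℝ => p.eval (x : ℂ) * Complex.exp ((l : ℂ) * x ^ 2 / 2 + b * x)) 2 volume := by
  obtain ⟨C, hC⟩ := exists_norm_eval_le_exp_abs p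
  have h := (memLp_exp_neg_mul_sq_add_mul_abs (a := -(l / 2)) (by linarith) (1 + ‖b‖)).const_mul C
  refine h.mono' ?_ (Filter.Eventually.of_forall fun x => ?_)
  · have : Continuous fun x : ℝ => p.eval (x : ℂ) := p.continuous.comp Complex.continuous_ofReal
    exact Continuous.aestronglyMeasurable (by fun_prop)
  · rw [norm_mul]
    refine (mul_le_mul (hC x) (norm_cexp_quadratic_le l b x) (norm_nonneg _)
      ((norm_nonneg _).trans (hC x))).trans_eq ?_
    rw [mul_assoc, ← Real.exp_add]
    ring_nf

/-- A Gaussian factor turns a square-integrable function into one with all exponential moments. -/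
lemma integrable_exp_mul_norm_mul_cexp_quadratic {l : ℝ} (hl : l < 0) (b : ℂ) {u : ℝ → ℂ}
    (hu : MemLp u 2 volume) (R : ℝ) :
    Integrable (fun x : ℝ => Real.exp (R * |x|) *
      ‖u x * Complex.exp ((l : ℂ) * x ^ 2 / 2 + b * x)‖) := by
  have h := (memLp_exp_neg_mul_sq_add_mul_abs (a := -(l / 2)) (by linarith) (R + ‖b‖))
  have h2 := h.integrable_mul hu.norm
  refine h2.mono' ?_ (Filter.Eventually.of_forall fun x => ?_)
  · have := hu.1
    have h3 : Continuous fun x : ℝ => Complex.exp ((l : ℂ) * x ^ 2 / 2 + b * x) := by fun_prop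
    have h4 : Continuous fun x : ℝ => Real.exp (R * |x|) := by fun_prop
    exact h4.aestronglyMeasurable.mul (this.mul h3.aestronglyMeasurable).norm
  · rw [Real.norm_of_nonneg (by positivity), norm_mul]
    have := norm_cexp_quadratic_le l b x
    calc _ ≤ Real.exp (R * |x|) * (‖u x‖ * Real.exp (l / 2 * x ^ 2 + ‖b‖ * |x|)) := by gcongr
      _ = Real.exp (R * |x| + (l / 2 * x ^ 2 + ‖b‖ * |x|)) * ‖u x‖ := by
        rw [Real.exp_add (R * |x|)]; ring
      _ = _ := by
        simp only [Pi.mul_apply]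
        ring_nf

/-! ### Functions with exponential moments are determined by their moments -/

lemma integrable_pow_mul_of_exp_moment {p : ℝ → ℂ} (hp : Continuous p)
    (hint : ∀ R : ℝ, Integrable (fun x => Real.exp (R * |x|) * ‖p x‖)) (k : ℕ) :
    Integrable (fun x : ℝ => (x : ℂ) ^ k * p x) := by
  refine ((hint 1).const_mul (k.factorial : ℝ)).mono'
    (Continuous.aestronglyMeasurable (by fun_prop)) (Filter.Eventually.of_forall fun x => ?_)
  rw [norm_mul, norm_pow, Complex.norm_real, Real.norm_eq_abs, one_mul, ← mul_assoc]
  exact mul_le_mul_of_nonneg_right (norm_pow_le_exp_abs k x) (norm_nonneg _)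

-- The exponential is expanded in its power series and integrated termwise; the exponential moment
-- with `R = ‖s‖` is the integral of the dominating series.
open FourierTransform in
lemma fourier_eq_zero_of_moments_eq_zero {p : ℝ → ℂ} (hp : Continuous p)
    (hint : ∀ R : ℝ, Integrable (fun x => Real.exp (R * |x|) * ‖p x‖))
    (hm : ∀ k : ℕ, ∫ x : ℝ, (x : ℂ) ^ k * p x = 0) (ξ : ℝ) : 𝓕 p ξ = 0 := by
  rw [Real.fourier_real_eq_integral_exp_smul]
  set s : ℂ := -2 * Real.pi * ξ * Complex.I with hs
  have key : HasSum (fun k : ℕ => ∫ x : ℝ, (s ^ k / k.factorial) * ((x : ℂ) ^ k * p x))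
      (∫ x : ℝ, Complex.exp (↑(-2 * Real.pi * x * ξ) * Complex.I) • p x) := by
    refine hasSum_integral_of_dominated_convergence
      (fun k x => (‖s‖ * |x|) ^ k / k.factorial * ‖p x‖)
      (fun k => Continuous.aestronglyMeasurable (by fun_prop))
      (fun k => Filter.Eventually.of_forall fun x => ?_)
      (Filter.Eventually.of_forall fun x => ?_) ?_ (Filter.Eventually.of_forall fun x => ?_)
    · simp only [norm_mul, norm_div, norm_pow, Complex.norm_real, Complex.norm_natCast,
        Real.norm_eq_abs]
      apply le_of_eq
      ring
    · exact (Real.summable_pow_div_factorial _).mul_right _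
    · refine (hint ‖s‖).congr (Filter.Eventually.of_forall fun x => ?_)
      beta_reduce
      rw [tsum_mul_right, Real.exp_eq_exp_ℝ, NormedSpace.exp_eq_tsum_div]
    · have h := (NormedSpace.expSeries_div_hasSum_exp (s * (x : ℂ))).mul_right (p x)
      rw [← Complex.exp_eq_exp_ℂ] at h
      have h1 : Complex.exp (↑(-2 * Real.pi * x * ξ) * Complex.I) = Complex.exp (s * x) := by
        rw [hs]; push_cast; ring_nf
      rw [h1, smul_eq_mul]
      refine h.congr_fun fun k => ?_
      ring
  refine key.unique ?_
  simp_rw [integral_const_mul, hm, mul_zero]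
  exact hasSum_zero

open FourierTransform in
theorem eq_zero_of_moments_eq_zero {p : ℝ → ℂ} (hp : Continuous p)
    (hint : ∀ R : ℝ, Integrable (fun x => Real.exp (R * |x|) * ‖p x‖))
    (hm : ∀ k : ℕ, ∫ x : ℝ, (x : ℂ) ^ k * p x = 0) : p = 0 := by
  have hF : 𝓕 p = 0 := funext fun ξ => fourier_eq_zero_of_moments_eq_zero hp hint hm ξ
  have hpi : Integrable p := by simpa using integrable_pow_mul_of_exp_moment hp hint 0
  have h := hp.fourierInv_fourier_eq hpi (by rw [hF]; exact integrable_zero _ _ _)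
  rw [← h, hF]
  funext x
  simp [Real.fourierInv_eq]

/-! ### Generalized Hermite polynomials -/

/-- The polynomials given by `H₀ = 1` and `Hₙ₊₁ = (d X + b) Hₙ - dHₙ/dX`; up to normalization,
Hermite polynomials in the variable `d X + b`. -/
noncomputable def hermitePoly (d b : ℂ) : ℕ → Polynomial ℂ
  | 0 => 1
  | n + 1 => (Polynomial.C d * Polynomial.X + Polynomial.C b) * hermitePoly d b n
      - Polynomial.derivative (hermitePoly d b n)

/-- This is the Hermite equation. Its case `n` yields `Hₙ₊₁' = d(n+1)Hₙ`, and differentiating that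
identity yields the case `n + 1`. -/
lemma derivative_derivative_hermitePoly (d b : ℂ) (n : ℕ) :
    Polynomial.derivative (Polynomial.derivative (hermitePoly d b n)) =
      (Polynomial.C d * Polynomial.X + Polynomial.C b) *
          Polynomial.derivative (hermitePoly d b n)
        - Polynomial.C d * (n : Polynomial ℂ) * hermitePoly d b n := by
  induction n with
  | zero => simp [hermitePoly]
  | succ n ih =>
    have h : Polynomial.derivative (hermitePoly d b (n + 1)) =
        Polynomial.C d * ((n : Polynomial ℂ) + 1) * hermitePoly d b n := by
      simp only [hermitePoly, Polynomial.derivative_sub, Polynomial.derivative_mul,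
        Polynomial.derivative_add, Polynomial.derivative_C, Polynomial.derivative_X, ih]
      ring
    rw [h]
    simp only [hermitePoly, Polynomial.derivative_mul,
      Polynomial.derivative_add, Polynomial.derivative_C, Polynomial.derivative_natCast,
      Polynomial.derivative_one]
    push_cast
    ring

lemma derivative_hermitePoly_succ (d b : ℂ) (n : ℕ) :
    Polynomial.derivative (hermitePoly d b (n + 1)) =
      Polynomial.C d * ((n : Polynomial ℂ) + 1) * hermitePoly d b n := by
  simp only [hermitePoly, Polynomial.derivative_sub, Polynomial.derivative_mul,
    Polynomial.derivative_add, Polynomial.derivative_C, Polynomial.derivative_X,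
    derivative_derivative_hermitePoly]
  ring

/-- As `d ≠ 0`, the lowering identity would pass the vanishing of `Hₙ₊₁` down to `Hₙ`. -/
lemma hermitePoly_ne_zero {d : ℂ} (hd : d ≠ 0) (b : ℂ) (n : ℕ) : hermitePoly d b n ≠ 0 := by
  induction n with
  | zero => simp [hermitePoly]
  | succ n ih =>
    intro h
    have h1 := derivative_hermitePoly_succ d b n
    rw [h, Polynomial.derivative_zero] at h1
    have h2 : ((n : Polynomial ℂ) + 1) ≠ 0 := by exact_mod_cast n.succ_ne_zero
    exact mul_ne_zero (mul_ne_zero (Polynomial.C_ne_zero.2 hd) h2) ih h1.symm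

lemma Polynomial.eq_zero_of_eval_ofReal_eq_zero {p : Polynomial ℂ}
    (h : ∀ x : ℝ, p.eval (x : ℂ) = 0) : p = 0 := by
  refine p.eq_zero_of_infinite_isRoot ((Set.infinite_range_of_injective
    Complex.ofReal_injective).mono ?_)
  rintro _ ⟨x, rfl⟩
  exact h x

/-! ### The system in components -/

lemma isSolution_iff {A B : Matrix (Fin 2) (Fin 2) ℂ} {f g : ℝ → ℂ} :
    IsSolution A B f g ↔ ∀ x : ℝ,
      HasDerivAt f ((x * A 0 0 + B 0 0) * f x + (x * A 0 1 + B 0 1) * g x) x ∧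
      HasDerivAt g ((x * A 1 0 + B 1 0) * f x + (x * A 1 1 + B 1 1) * g x) x := by
  refine forall_congr' fun x => ?_
  rw [hasDerivAt_pi, Fin.forall_fin_two]
  simp [Matrix.mulVec, dotProduct, Fin.sum_univ_two]

lemma IsSolution.conj {A B : Matrix (Fin 2) (Fin 2) ℂ} {f g : ℝ → ℂ} (h : IsSolution A B f g)
    (P : GL (Fin 2) ℂ) :
    IsSolution (P.val * A * P⁻¹.val) (P.val * B * P⁻¹.val)
      (fun x => P.val 0 0 * f x + P.val 0 1 * g x)
      (fun x => P.val 1 0 * f x + P.val 1 1 * g x) := by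
  intro x
  have hPP : P⁻¹.val * P.val = 1 := by rw [← Units.val_mul, inv_mul_cancel, Units.val_one]
  have hmul : ∀ t : ℝ, ![P.val 0 0 * f t + P.val 0 1 * g t, P.val 1 0 * f t + P.val 1 1 * g t]
      = P.val.mulVec ![f t, g t] := by
    intro t
    ext i
    fin_cases i <;> simp [Matrix.mulVec, dotProduct, Fin.sum_univ_two]
  simp only [hmul]
  have h1 : ((x : ℂ) • (P.val * A * P⁻¹.val) + P.val * B * P⁻¹.val).mulVec
      (P.val.mulVec ![f x, g x]) = P.val.mulVec (((x : ℂ) • A + B).mulVec ![f x, g x]) := by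
    rw [Matrix.mulVec_mulVec, Matrix.mulVec_mulVec]
    congr 1
    rw [add_mul, smul_mul_assoc, mul_assoc _ _ P.val, mul_assoc _ _ P.val, hPP, mul_one, mul_one,
      mul_add, Matrix.mul_smul]
  rw [h1]
  have h2 := hasDerivAt_pi.1 (h x)
  refine hasDerivAt_pi.2 fun i => ?_
  simp only [Matrix.mulVec, dotProduct]
  exact HasDerivAt.fun_sum fun j _ => (h2 j).const_mul (P.val i j)

lemma IsL2Solution.conj {A B : Matrix (Fin 2) (Fin 2) ℂ} {f g : ℝ → ℂ}
    (h : IsL2Solution A B f g) (P : GL (Fin 2) ℂ) :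
    IsL2Solution (P.val * A * P⁻¹.val) (P.val * B * P⁻¹.val)
      (fun x => P.val 0 0 * f x + P.val 0 1 * g x)
      (fun x => P.val 1 0 * f x + P.val 1 1 * g x) :=
  ⟨h.1.conj P, (h.2.1.const_mul _).add (h.2.2.const_mul _),
    (h.2.1.const_mul _).add (h.2.2.const_mul _)⟩

/-- Undoing a linear change of the unknown functions. -/
lemma inv_apply_combination (P : GL (Fin 2) ℂ) (f g : ℂ) :
    P⁻¹.val 0 0 * (P.val 0 0 * f + P.val 0 1 * g) + P⁻¹.val 0 1 * (P.val 1 0 * f + P.val 1 1 * g)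
      = f ∧
    P⁻¹.val 1 0 * (P.val 0 0 * f + P.val 0 1 * g) + P⁻¹.val 1 1 * (P.val 1 0 * f + P.val 1 1 * g)
      = g := by
  have hPP : P⁻¹.val * P.val = 1 := by rw [← Units.val_mul, inv_mul_cancel, Units.val_one]
  have e : ∀ i j, (P⁻¹.val * P.val) i j = (1 : Matrix (Fin 2) (Fin 2) ℂ) i j :=
    fun i j => by rw [hPP]
  have e00 := e 0 0
  have e01 := e 0 1
  have e10 := e 1 0
  have e11 := e 1 1
  simp only [Matrix.mul_apply, Fin.sum_univ_two, Matrix.one_apply_eq, ne_eq, zero_ne_one,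
    one_ne_zero, not_false_eq_true, Matrix.one_apply_ne] at e00 e01 e10 e11
  constructor
  · linear_combination f * e00 + g * e01
  · linear_combination f * e10 + g * e11

lemma HasNonzeroL2Solution.conj {A B : Matrix (Fin 2) (Fin 2) ℂ}
    (h : HasNonzeroL2Solution A B) (P : GL (Fin 2) ℂ) :
    HasNonzeroL2Solution (P.val * A * P⁻¹.val) (P.val * B * P⁻¹.val) := by
  obtain ⟨f, g, hfg, hne⟩ := h
  refine ⟨_, _, hfg.conj P, ?_⟩
  by_contra! hz
  have hz1 := fun x => congrFun hz.1 x
  have hz2 := fun x => congrFun hz.2 x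
  simp only [Pi.zero_apply] at hz1 hz2
  have h1 : ∀ x, f x = 0 ∧ g x = 0 := fun x => by
    obtain ⟨h1, h2⟩ := inv_apply_combination P (f x) (g x)
    simp only [hz1, hz2, mul_zero, add_zero] at h1 h2
    exact ⟨h1.symm, h2.symm⟩
  rcases hne with hne | hne
  · exact hne (funext fun x => (h1 x).1)
  · exact hne (funext fun x => (h1 x).2)

lemma hasNonzeroL2Solution_conj_iff {A B : Matrix (Fin 2) (Fin 2) ℂ} (P : GL (Fin 2) ℂ) :
    HasNonzeroL2Solution (P.val * A * P⁻¹.val) (P.val * B * P⁻¹.val) ↔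
      HasNonzeroL2Solution A B := by
  refine ⟨fun h => ?_, fun h => h.conj P⟩
  have hPP : P⁻¹.val * P.val = 1 := by rw [← Units.val_mul, inv_mul_cancel, Units.val_one]
  have e : ∀ M : Matrix (Fin 2) (Fin 2) ℂ,
      P⁻¹.val * (P.val * M * P⁻¹.val) * (P⁻¹)⁻¹.val = M := fun M => by
    rw [inv_inv, ← mul_assoc, ← mul_assoc, hPP, one_mul, mul_assoc, hPP, mul_one]
  simpa only [e] using h.conj P⁻¹

/-- Interchanging the two unknown functions. -/
lemma HasNonzeroL2Solution.swap {A B : Matrix (Fin 2) (Fin 2) ℂ}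
    (h : HasNonzeroL2Solution A B) :
    HasNonzeroL2Solution (A.submatrix (Equiv.swap 0 1) (Equiv.swap 0 1))
      (B.submatrix (Equiv.swap 0 1) (Equiv.swap 0 1)) := by
  obtain ⟨f, g, ⟨hs, hf, hg⟩, hne⟩ := h
  refine ⟨g, f, ⟨isSolution_iff.2 fun x => ?_, hg, hf⟩, hne.symm⟩
  have := isSolution_iff.1 hs x
  simp only [Matrix.submatrix_apply, Equiv.swap_apply_left, Equiv.swap_apply_right]
  exact ⟨this.2.congr_deriv (add_comm _ _), this.1.congr_deriv (add_comm _ _)⟩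

lemma hasNonzeroL2Solution_swap_iff {A B : Matrix (Fin 2) (Fin 2) ℂ} :
    HasNonzeroL2Solution (A.submatrix (Equiv.swap 0 1) (Equiv.swap 0 1))
      (B.submatrix (Equiv.swap 0 1) (Equiv.swap 0 1)) ↔ HasNonzeroL2Solution A B := by
  refine ⟨fun h => ?_, fun h => h.swap⟩
  have := h.swap
  simpa [Matrix.submatrix_submatrix, ← Equiv.coe_trans] using this

/-- `(u, v)` solves the system whose leading matrix is `diag (l₁, l₂)`. -/
def IsDiagSolution (l₁ l₂ : ℝ) (b₁ b₂ b₃ b₄ : ℂ) (u v : ℝ → ℂ) : Prop :=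
  ∀ x : ℝ, HasDerivAt u ((l₁ * x + b₁) * u x + b₂ * v x) x ∧
    HasDerivAt v (b₃ * u x + (l₂ * x + b₄) * v x) x

lemma isSolution_iff_isDiagSolution {D B : Matrix (Fin 2) (Fin 2) ℂ} {l₁ l₂ : ℝ}
    (hD : D.IsDiag) (h₁ : D 0 0 = l₁) (h₂ : D 1 1 = l₂) {u v : ℝ → ℂ} :
    IsSolution D B u v ↔ IsDiagSolution l₁ l₂ (B 0 0) (B 0 1) (B 1 0) (B 1 1) u v := by
  rw [isSolution_iff]
  refine forall_congr' fun x => ?_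
  rw [h₁, h₂, hD (zero_ne_one), hD (one_ne_zero)]
  simp only [mul_zero, zero_add, mul_comm (x : ℂ) (l₁ : ℂ), mul_comm (x : ℂ) (l₂ : ℂ)]

/-! ### The existence criterion -/

lemma exists_isDiagSolution_of_eq {l₁ l₂ : ℝ} (hl : l₂ < l₁) (hl₂ : l₂ < 0) {b₁ b₂ b₃ b₄ : ℂ}
    {n : ℤ} (hn : n < 0) (hb : b₂ * b₃ = ((l₁ : ℂ) - l₂) * n) :
    ∃ u v : ℝ → ℂ, IsDiagSolution l₁ l₂ b₁ b₂ b₃ b₄ u v ∧ MemLp u 2 volume ∧ MemLp v 2 volume ∧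
      v ≠ 0 := by
  obtain ⟨m, rfl⟩ : ∃ m : ℕ, n = -(m : ℤ) := ⟨n.natAbs, by omega⟩
  have hd : (l₁ : ℂ) - l₂ ≠ 0 := sub_ne_zero.2 (by exact_mod_cast hl.ne')
  have hb₃ : b₃ ≠ 0 := by
    rintro rfl
    rw [mul_zero] at hb
    exact mul_ne_zero hd (by exact_mod_cast hn.ne) hb.symm
  -- With `u = zE`, `v = wE`, `E = exp(l₂x²/2 + b₄x)`, the system reads `w' = b₃z` and `w'' = (dx +
  -- b₁ - b₄)w' + b₂b₃w`, the Hermite equation of degree `m`.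
  set d : ℂ := (l₁ : ℂ) - l₂ with hd_def
  set w := hermitePoly d (b₁ - b₄) m with hw
  set z := Polynomial.C b₃⁻¹ * Polynomial.derivative w with hz
  refine ⟨fun x => z.eval (x : ℂ) * Complex.exp ((l₂ : ℂ) * x ^ 2 / 2 + b₄ * x),
    fun x => w.eval (x : ℂ) * Complex.exp ((l₂ : ℂ) * x ^ 2 / 2 + b₄ * x), fun x => ?_,
    memLp_eval_mul_cexp_quadratic hl₂ _ _, memLp_eval_mul_cexp_quadratic hl₂ _ _, ?_⟩
  · have hE := hasDerivAt_cexp_quadratic (l₂ : ℂ) b₄ x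
    have hpoly : ∀ p : Polynomial ℂ, HasDerivAt (fun t : ℝ => p.eval (t : ℂ))
        ((Polynomial.derivative p).eval (x : ℂ)) x := fun p => (p.hasDerivAt (x : ℂ)).comp_ofReal
    have hode := congrArg (Polynomial.eval (x : ℂ))
      (derivative_derivative_hermitePoly d (b₁ - b₄) m)
    rw [← hw] at hode
    simp only [Polynomial.eval_sub, Polynomial.eval_mul, Polynomial.eval_add, Polynomial.eval_C,
      Polynomial.eval_X, Polynomial.eval_natCast] at hode
    constructor
    · refine ((hpoly z).mul hE).congr_deriv ?_
      simp only [hz, Polynomial.derivative_mul, Polynomial.derivative_C, zero_mul, zero_add,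
        Polynomial.eval_mul, Polynomial.eval_C, hode]
      push_cast at hb
      field_simp
      linear_combination (-Polynomial.eval (x : ℂ) w) * hb + (x : ℂ) *
        Polynomial.eval (x : ℂ) (Polynomial.derivative w) * hd_def
    · refine ((hpoly w).mul hE).congr_deriv ?_
      simp only [hz, Polynomial.eval_mul, Polynomial.eval_C]
      field_simp
  · intro h0
    refine hermitePoly_ne_zero hd (b₁ - b₄) m
      (Polynomial.eq_zero_of_eval_ofReal_eq_zero fun x => ?_)
    have := congrFun h0 x
    simpa [Complex.exp_ne_zero] using this

lemma eq_zero_of_isDiagSolution {l₁ l₂ : ℝ} (hl₁ : 0 < l₁) {b₁ b₂ b₃ b₄ : ℂ}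
    (hb₂ : b₂ ≠ 0) (hb : ¬ ∃ n : ℤ, n < 0 ∧ b₂ * b₃ = ((l₁ : ℂ) - l₂) * n) {u v : ℝ → ℂ}
    (h : IsDiagSolution l₁ l₂ b₁ b₂ b₃ b₄ u v) (hu : MemLp u 2 volume) (hv : MemLp v 2 volume) :
    u = 0 ∧ v = 0 := by
  -- This integrating factor cancels the diagonal term of the `u` equation, leaving `p' = b₂y`.
  set E : ℝ → ℂ := fun x => Complex.exp (((-l₁ : ℝ) : ℂ) * x ^ 2 / 2 + (-b₁) * x) with hE_def
  set p : ℝ → ℂ := fun x => u x * E x with hp_def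
  set y : ℝ → ℂ := fun x => v x * E x with hy_def
  set d : ℂ := (l₁ : ℂ) - l₂ with hd_def
  have hE : ∀ x : ℝ, HasDerivAt E (-(l₁ * x + b₁) * E x) x := fun x =>
    (hasDerivAt_cexp_quadratic ((-l₁ : ℝ) : ℂ) (-b₁) x).congr_deriv
      (by simp only [hE_def]; push_cast; ring)
  have hp : ∀ x : ℝ, HasDerivAt p (b₂ * y x) x := fun x =>
    ((h x).1.mul (hE x)).congr_deriv (by simp only [hy_def]; ring)
  have hy : ∀ x : ℝ, HasDerivAt y (b₃ * p x - (d * x + (b₁ - b₄)) * y x) x := fun x =>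
    ((h x).2.mul (hE x)).congr_deriv (by simp only [hy_def, hp_def, hd_def]; ring)
  have hpc : Continuous p := continuous_iff_continuousAt.2 fun x => (hp x).continuousAt
  have hyc : Continuous y := continuous_iff_continuousAt.2 fun x => (hy x).continuousAt
  have hpe : ∀ R : ℝ, Integrable (fun x => Real.exp (R * |x|) * ‖p x‖) :=
    integrable_exp_mul_norm_mul_cexp_quadratic (neg_lt_zero.2 hl₁) _ hu
  have hye : ∀ R : ℝ, Integrable (fun x => Real.exp (R * |x|) * ‖y x‖) :=
    integrable_exp_mul_norm_mul_cexp_quadratic (neg_lt_zero.2 hl₁) _ hv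
  have hpi := integrable_pow_mul_of_exp_moment hpc hpe
  have hyi := integrable_pow_mul_of_exp_moment hyc hye
  have hpow : ∀ (k : ℕ) (x : ℝ), HasDerivAt (fun t : ℝ => (t : ℂ) ^ k) (k * (x : ℂ) ^ (k - 1)) x :=
    fun k x => (hasDerivAt_pow k (x : ℂ)).comp_ofReal
  -- The truncated exponent at `k = 0` is harmless, since the factor `k` vanishes there.
  have hM : ∀ k : ℕ, (k : ℂ) * (∫ x : ℝ, (x : ℂ) ^ (k - 1) * p x)
      + b₂ * (∫ x : ℝ, (x : ℂ) ^ k * y x) = 0 := fun k => by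
    rw [← integral_const_mul, ← integral_const_mul,
      ← integral_add ((hpi _).const_mul _) ((hyi _).const_mul _)]
    refine integral_eq_zero_of_hasDerivAt_of_integrable (f := fun x : ℝ => (x : ℂ) ^ k * p x)
      (fun x => ((hpow k x).mul (hp x)).congr_deriv (by ring))
      (((hpi _).const_mul _).add ((hyi _).const_mul _)) (hpi k)
  have hN : ∀ k : ℕ, (k : ℂ) * (∫ x : ℝ, (x : ℂ) ^ (k - 1) * y x)
      + b₃ * (∫ x : ℝ, (x : ℂ) ^ k * p x) - d * (∫ x : ℝ, (x : ℂ) ^ (k + 1) * y x)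
      - (b₁ - b₄) * (∫ x : ℝ, (x : ℂ) ^ k * y x) = 0 := fun k => by
    have i1 := (hyi (k - 1)).const_mul (k : ℂ)
    have i2 := (hpi k).const_mul b₃
    have i3 := (hyi (k + 1)).const_mul d
    have i4 := (hyi k).const_mul (b₁ - b₄)
    have i12 := i1.fun_add i2
    have i123 : Integrable fun x : ℝ => (k : ℂ) * ((x : ℂ) ^ (k - 1) * y x)
        + b₃ * ((x : ℂ) ^ k * p x) - d * ((x : ℂ) ^ (k + 1) * y x) := i12.sub i3
    rw [← integral_const_mul, ← integral_const_mul, ← integral_const_mul, ← integral_const_mul,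
      ← integral_add i1 i2, ← integral_sub i12 i3, ← integral_sub i123 i4]
    refine integral_eq_zero_of_hasDerivAt_of_integrable (f := fun x : ℝ => (x : ℂ) ^ k * y x)
      (fun x => ((hpow k x).mul (hy x)).congr_deriv (by ring))
      (i123.sub i4) (hyi k)
  have hzero : ∀ k : ℕ, ∫ x : ℝ, (x : ℂ) ^ k * p x = 0 := fun k => by
    induction k using Nat.strong_induction_on with
    | _ k ih =>
      have hprev : (k : ℂ) * (∫ x : ℝ, (x : ℂ) ^ (k - 1) * p x) = 0 := by
        rcases Nat.eq_zero_or_pos k with rfl | hk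
        · simp
        · rw [ih (k - 1) (by omega), mul_zero]
      have hy0 : ∫ x : ℝ, (x : ℂ) ^ k * y x = 0 := by
        have := hM k
        rw [hprev, zero_add] at this
        exact (mul_eq_zero.1 this).resolve_left hb₂
      have hy1 : (k : ℂ) * ∫ x : ℝ, (x : ℂ) ^ (k - 1) * y x = 0 := by
        rcases Nat.eq_zero_or_pos k with rfl | hk
        · simp
        · have := hM (k - 1)
          have h2 : ((k - 1 : ℕ) : ℂ) * (∫ x : ℝ, (x : ℂ) ^ (k - 1 - 1) * p x) = 0 := by
            rw [ih (k - 1 - 1) (by omega), mul_zero]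
          rw [h2, zero_add] at this
          rw [(mul_eq_zero.1 this).resolve_left hb₂, mul_zero]
      -- What remains is `b₃Pₖ = dYₖ₊₁` and `(k+1)Pₖ + b₂Yₖ₊₁ = 0` for the moments `Pₖ`, `Yₖ` of
      -- `p`, `y`; eliminating `Yₖ₊₁` isolates `Pₖ`.
      have h1 := hM (k + 1)
      have h2 := hN k
      rw [hy0, hy1] at h2
      rw [Nat.add_sub_cancel] at h1
      push_cast at h1
      have h3 : (b₂ * b₃ + d * (k + 1)) * (∫ x : ℝ, (x : ℂ) ^ k * p x) = 0 := by
        linear_combination b₂ * h2 + d * h1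
      refine (mul_eq_zero.1 h3).resolve_left fun h4 => hb ⟨-((k : ℤ) + 1), by omega, ?_⟩
      push_cast
      linear_combination h4
  have hp0 : p = 0 := eq_zero_of_moments_eq_zero hpc hpe hzero
  have hu0 : u = 0 := funext fun x => by
    have := congrFun hp0 x
    simpa [hp_def, hE_def, Complex.exp_ne_zero] using this
  refine ⟨hu0, funext fun x => ?_⟩
  have h1 := (h x).1
  rw [hu0] at h1
  have h2 := h1.unique (hasDerivAt_const x (0 : ℂ))
  simpa [hb₂] using h2

/-! ### Decay of square-integrable solutions -/

/-- The real inner product is half the derivative of `‖u‖²` along the system; for large `|s|` its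
main part is `s‖u‖²`. -/
lemma abs_inner_add_mul_sub_le (s : ℝ) (b b' u v : ℂ) :
    |inner ℝ u ((s + b) * u + b' * v) - s * ‖u‖ ^ 2| ≤ ‖b‖ * ‖u‖ ^ 2 + ‖b'‖ * (‖u‖ * ‖v‖) := by
  have h : (s + b) * u + b' * v = s • u + (b * u + b' * v) := by
    rw [Complex.real_smul]; ring
  rw [h, inner_add_right, inner_smul_right, real_inner_self_eq_norm_sq, add_sub_cancel_left]
  refine (abs_real_inner_le_norm _ _).trans ?_
  have h1 : ‖b * u + b' * v‖ ≤ ‖b‖ * ‖u‖ + ‖b'‖ * ‖v‖ := by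
    simpa only [norm_mul] using norm_add_le (b * u) (b' * v)
  calc ‖u‖ * ‖b * u + b' * v‖ ≤ ‖u‖ * (‖b‖ * ‖u‖ + ‖b'‖ * ‖v‖) := by gcongr
    _ = _ := by ring

/-- Otherwise a positive constant would be integrable on a half-line. -/
lemma MeasureTheory.MemLp.exists_norm_sq_lt {u : ℝ → ℂ} (hu : MemLp u 2 volume) {ε : ℝ}
    (hε : 0 < ε) (a : ℝ) : ∃ x, a ≤ x ∧ ‖u x‖ ^ 2 < ε := by
  by_contra! hcon
  have h1 : IntegrableOn (fun x => ‖u x‖ ^ 2) (Set.Ici a) :=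
    ((memLp_two_iff_integrable_sq_norm hu.1).1 hu).integrableOn
  have h2 : IntegrableOn (fun _ : ℝ => ε) (Set.Ici a) := by
    refine h1.mono' aestronglyMeasurable_const ?_
    filter_upwards [ae_restrict_mem measurableSet_Ici] with x hx
    rw [Real.norm_of_nonneg hε.le]
    exact hcon x hx
  rw [integrableOn_const_iff] at h2
  simp [hε.ne'] at h2

lemma IsDiagSolution.exists_exp_bound_atTop {l₁ l₂ : ℝ} (hl₁ : 0 < l₁) (hl₂ : l₂ < 0)
    {b₁ b₂ b₃ b₄ : ℂ} {u v : ℝ → ℂ} (h : IsDiagSolution l₁ l₂ b₁ b₂ b₃ b₄ u v)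
    (hu : MemLp u 2 volume) :
    ∃ X : ℝ, 0 ≤ X ∧ ∃ C : ℝ, ∀ x, X ≤ x →
      Real.exp |x| * ‖u x‖ ≤ C ∧ Real.exp |x| * ‖v x‖ ≤ C := by
  set K : ℝ := ‖b₁‖ + ‖b₂‖ + ‖b₃‖ + ‖b₄‖ with hK
  have hb₁ := norm_nonneg b₁
  have hb₂ := norm_nonneg b₂
  have hb₃ := norm_nonneg b₃
  have hb₄ := norm_nonneg b₄
  have hK0 : 0 ≤ K := by positivity
  -- The `2K` absorbs every term coming from `B`; the extra `1` provides the decay rate `exp(-x)`.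
  obtain ⟨X, hX0, hX₁, hX₂⟩ : ∃ X : ℝ, 0 ≤ X ∧ (∀ x, X ≤ x → 2 * K + 1 ≤ l₁ * x) ∧
      ∀ x, X ≤ x → l₂ * x ≤ -(2 * K + 1) := by
    refine ⟨max ((2 * K + 1) / l₁) ((2 * K + 1) / -l₂), ?_, fun x hx => ?_, fun x hx => ?_⟩
    · exact le_max_of_le_left (by positivity)
    · have := (le_max_left _ _).trans hx
      rw [div_le_iff₀ hl₁] at this
      linarith
    · have := (le_max_right _ _).trans hx
      rw [div_le_iff₀ (neg_pos.2 hl₂)] at this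
      linarith
  set du : ℝ → ℝ := fun x => inner ℝ (u x) ((l₁ * x + b₁) * u x + b₂ * v x) with hdu
  set dv : ℝ → ℝ := fun x => inner ℝ (v x) (b₃ * u x + (l₂ * x + b₄) * v x) with hdv
  have hud : ∀ x, HasDerivAt (fun t => ‖u t‖ ^ 2) (2 * du x) x := fun x => (h x).1.norm_sq
  have hvd : ∀ x, HasDerivAt (fun t => ‖v t‖ ^ 2) (2 * dv x) x := fun x => (h x).2.norm_sq
  have hduge : ∀ x, X ≤ x →
      (2 * K + 1) * ‖u x‖ ^ 2 - K * ‖u x‖ ^ 2 - K * (‖u x‖ * ‖v x‖) ≤ du x := fun x hx => by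
    have h1 := (abs_le.1 (abs_inner_add_mul_sub_le (l₁ * x) b₁ b₂ (u x) (v x))).1
    push_cast at h1
    have h2 := mul_le_mul_of_nonneg_right (hX₁ x hx) (sq_nonneg ‖u x‖)
    have h3 := mul_le_mul_of_nonneg_right (show ‖b₁‖ ≤ K by linarith) (sq_nonneg ‖u x‖)
    have h4 := mul_le_mul_of_nonneg_right (show ‖b₂‖ ≤ K by linarith)
      (mul_nonneg (norm_nonneg (u x)) (norm_nonneg (v x)))
    simp only [hdu]
    linarith
  have hdvle : ∀ x, X ≤ x →
      dv x ≤ -(2 * K + 1) * ‖v x‖ ^ 2 + K * ‖v x‖ ^ 2 + K * (‖u x‖ * ‖v x‖) := fun x hx => by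
    have h1 := (abs_le.1 (abs_inner_add_mul_sub_le (l₂ * x) b₄ b₃ (v x) (u x))).2
    push_cast at h1
    rw [add_comm ((_ : ℂ) * v x)] at h1
    have h2 := mul_le_mul_of_nonneg_right (hX₂ x hx) (sq_nonneg ‖v x‖)
    have h3 := mul_le_mul_of_nonneg_right (show ‖b₄‖ ≤ K by linarith) (sq_nonneg ‖v x‖)
    have h4 := mul_le_mul_of_nonneg_right (show ‖b₃‖ ≤ K by linarith)
      (mul_nonneg (norm_nonneg (v x)) (norm_nonneg (u x)))
    simp only [hdv]
    linarith
  have hmono : MonotoneOn (fun x => ‖u x‖ ^ 2 - ‖v x‖ ^ 2) (Set.Ici X) := by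
    have hd : ∀ x, HasDerivAt (fun x => ‖u x‖ ^ 2 - ‖v x‖ ^ 2) (2 * du x - 2 * dv x) x :=
      fun x => (hud x).sub (hvd x)
    refine monotoneOn_of_deriv_nonneg (convex_Ici X)
      (fun x _ => (hd x).continuousAt.continuousWithinAt)
      (fun x _ => (hd x).differentiableAt.differentiableWithinAt) fun x hx => ?_
    rw [interior_Ici] at hx
    rw [(hd x).deriv]
    have h1 := hduge x (le_of_lt hx)
    have h2 := hdvle x (le_of_lt hx)
    have h3 := mul_nonneg hK0 (sq_nonneg (‖u x‖ - ‖v x‖))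
    nlinarith [sq_nonneg ‖u x‖, sq_nonneg ‖v x‖]
  -- If `‖u‖ > ‖v‖` at one point, monotonicity would keep `‖u‖²` above a positive constant from
  -- there on.
  have hcone : ∀ x, X ≤ x → ‖u x‖ ≤ ‖v x‖ := fun x hx => by
    by_contra! hlt
    have hpos : 0 < ‖u x‖ ^ 2 - ‖v x‖ ^ 2 := by
      have := pow_lt_pow_left₀ hlt (norm_nonneg _) two_ne_zero
      linarith
    obtain ⟨y, hxy, hy⟩ := hu.exists_norm_sq_lt hpos x
    have := hmono hx (hx.trans hxy) hxy
    dsimp only at this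
    linarith [sq_nonneg ‖v y‖]
  have hanti : AntitoneOn (fun x => Real.exp (2 * x) * ‖v x‖ ^ 2) (Set.Ici X) := by
    have hd : ∀ x, HasDerivAt (fun x => Real.exp (2 * x) * ‖v x‖ ^ 2)
        (2 * Real.exp (2 * x) * (‖v x‖ ^ 2 + dv x)) x := fun x => by
      have := (((hasDerivAt_id x).const_mul 2).exp).mul (hvd x)
      refine this.congr_deriv ?_
      simp only [id]
      ring
    refine antitoneOn_of_deriv_nonpos (convex_Ici X)
      (fun x _ => (hd x).continuousAt.continuousWithinAt)
      (fun x _ => (hd x).differentiableAt.differentiableWithinAt) fun x hx => ?_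
    rw [interior_Ici] at hx
    rw [(hd x).deriv]
    refine mul_nonpos_of_nonneg_of_nonpos (by positivity) ?_
    have h2 := hdvle x (le_of_lt hx)
    have h3 := mul_le_mul_of_nonneg_left
      (mul_le_mul_of_nonneg_right (hcone x (le_of_lt hx)) (norm_nonneg (v x))) hK0
    nlinarith
  have hbound : ∀ x, X ≤ x → Real.exp |x| * ‖v x‖ ≤ Real.exp X * ‖v X‖ := fun x hx => by
    have h1 := hanti Set.self_mem_Ici hx hx
    dsimp only at h1
    rw [abs_of_nonneg (hX0.trans hx)]
    refine le_of_sq_le_sq ?_ (by positivity)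
    rw [mul_pow, mul_pow, ← Real.exp_nat_mul, ← Real.exp_nat_mul]
    exact_mod_cast h1
  refine ⟨X, hX0, Real.exp X * ‖v X‖, fun x hx => ⟨?_, hbound x hx⟩⟩
  exact (mul_le_mul_of_nonneg_left (hcone x hx) (Real.exp_pos _).le).trans (hbound x hx)

/-- Reflection changes only the sign of `B`, so the estimate at `+∞` also serves at `-∞`. -/
lemma IsDiagSolution.reflect {l₁ l₂ : ℝ} {b₁ b₂ b₃ b₄ : ℂ} {u v : ℝ → ℂ}
    (h : IsDiagSolution l₁ l₂ b₁ b₂ b₃ b₄ u v) :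
    IsDiagSolution l₁ l₂ (-b₁) (-b₂) (-b₃) (-b₄) (fun x => u (-x)) (fun x => v (-x)) := by
  intro x
  have h1 := (h (-x)).1.scomp x (hasDerivAt_neg x)
  have h2 := (h (-x)).2.scomp x (hasDerivAt_neg x)
  constructor
  · refine h1.congr_deriv ?_
    simp only [neg_smul, one_smul]
    push_cast
    ring
  · refine h2.congr_deriv ?_
    simp only [neg_smul, one_smul]
    push_cast
    ring

lemma IsDiagSolution.exists_exp_bound {l₁ l₂ : ℝ} (hl₁ : 0 < l₁) (hl₂ : l₂ < 0)
    {b₁ b₂ b₃ b₄ : ℂ} {u v : ℝ → ℂ} (h : IsDiagSolution l₁ l₂ b₁ b₂ b₃ b₄ u v)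
    (hu : MemLp u 2 volume) :
    ∃ C : ℝ, ∀ x, Real.exp |x| * ‖u x‖ ≤ C ∧ Real.exp |x| * ‖v x‖ ≤ C := by
  obtain ⟨X, hX, C, hC⟩ := h.exists_exp_bound_atTop hl₁ hl₂ hu
  obtain ⟨Y, hY, D, hD⟩ := h.reflect.exists_exp_bound_atTop hl₁ hl₂
    (hu.comp_measurePreserving (Measure.measurePreserving_neg volume))
  have hcu : Continuous u := continuous_iff_continuousAt.2 fun x => (h x).1.continuousAt
  have hcv : Continuous v := continuous_iff_continuousAt.2 fun x => (h x).2.continuousAt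
  obtain ⟨M, hM⟩ := (isCompact_Icc (a := -Y) (b := X)).exists_bound_of_continuousOn
    (f := fun x => Real.exp |x| * (‖u x‖ + ‖v x‖)) (by fun_prop)
  refine ⟨max (max C D) M, fun x => ?_⟩
  rcases le_total X x with hx | hx
  · exact ⟨le_max_of_le_left (le_max_of_le_left (hC x hx).1),
      le_max_of_le_left (le_max_of_le_left (hC x hx).2)⟩
  rcases le_total x (-Y) with hy | hy
  · have := hD (-x) (by linarith)
    rw [abs_neg, neg_neg] at this
    exact ⟨le_max_of_le_left (le_max_of_le_right this.1),
      le_max_of_le_left (le_max_of_le_right this.2)⟩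
  · have := (Real.le_norm_self _).trans (hM x ⟨hy, hx⟩)
    have h1 : 0 ≤ Real.exp |x| * ‖u x‖ := by positivity
    have h2 : 0 ≤ Real.exp |x| * ‖v x‖ := by positivity
    rw [mul_add] at this
    exact ⟨le_max_of_le_right (by linarith), le_max_of_le_right (by linarith)⟩

/-! ### Exponentially decaying solutions are Schwartz -/

/-- The polynomial span of `f` and `g` is stable under differentiation, which controls all
derivatives at once. -/
lemma IsSolution.hasDerivAt_combination {A B : Matrix (Fin 2) (Fin 2) ℂ} {f g : ℝ → ℂ}
    (h : IsSolution A B f g) (p q : Polynomial ℂ) :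
    ∃ p' q' : Polynomial ℂ, ∀ x : ℝ,
      HasDerivAt (fun t : ℝ => p.eval (t : ℂ) * f t + q.eval (t : ℂ) * g t)
        (p'.eval (x : ℂ) * f x + q'.eval (x : ℂ) * g x) x := by
  refine ⟨Polynomial.derivative p
      + p * (Polynomial.X * Polynomial.C (A 0 0) + Polynomial.C (B 0 0))
      + q * (Polynomial.X * Polynomial.C (A 1 0) + Polynomial.C (B 1 0)),
    Polynomial.derivative q
      + p * (Polynomial.X * Polynomial.C (A 0 1) + Polynomial.C (B 0 1))
      + q * (Polynomial.X * Polynomial.C (A 1 1) + Polynomial.C (B 1 1)), fun x => ?_⟩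
  have hs := isSolution_iff.1 h x
  have hpoly : ∀ p : Polynomial ℂ, HasDerivAt (fun t : ℝ => p.eval (t : ℂ))
      ((Polynomial.derivative p).eval (x : ℂ)) x := fun p => (p.hasDerivAt (x : ℂ)).comp_ofReal
  refine (((hpoly p).mul hs.1).add ((hpoly q).mul hs.2)).congr_deriv ?_
  simp only [Polynomial.eval_add, Polynomial.eval_mul, Polynomial.eval_X, Polynomial.eval_C]
  ring

lemma IsSolution.iteratedDeriv_combination {A B : Matrix (Fin 2) (Fin 2) ℂ} {f g : ℝ → ℂ}
    (h : IsSolution A B f g) (n : ℕ) (p q : Polynomial ℂ) :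
    ∃ p' q' : Polynomial ℂ,
      iteratedDeriv n (fun t : ℝ => p.eval (t : ℂ) * f t + q.eval (t : ℂ) * g t)
        = fun t : ℝ => p'.eval (t : ℂ) * f t + q'.eval (t : ℂ) * g t := by
  induction n generalizing p q with
  | zero => exact ⟨p, q, iteratedDeriv_zero⟩
  | succ n ih =>
    obtain ⟨p', q', h'⟩ := h.hasDerivAt_combination p q
    rw [iteratedDeriv_succ', funext fun x => (h' x).deriv]
    exact ih p' q'

lemma IsSolution.isSchwartz_combination {A B : Matrix (Fin 2) (Fin 2) ℂ} {f g : ℝ → ℂ}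
    (h : IsSolution A B f g) {C : ℝ}
    (hC : ∀ x, Real.exp |x| * ‖f x‖ ≤ C ∧ Real.exp |x| * ‖g x‖ ≤ C) (p q : Polynomial ℂ) :
    IsSchwartz (fun t : ℝ => p.eval (t : ℂ) * f t + q.eval (t : ℂ) * g t) := by
  refine ⟨⟨fun t : ℝ => p.eval (t : ℂ) * f t + q.eval (t : ℂ) * g t, ?_, fun k n => ?_⟩,
    fun x => rfl⟩
  · refine contDiff_of_differentiable_iteratedDeriv fun n _ => ?_
    obtain ⟨p', q', h'⟩ := h.iteratedDeriv_combination n p q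
    obtain ⟨p'', q'', h''⟩ := h.hasDerivAt_combination p' q'
    rw [h']
    exact fun x => (h'' x).differentiableAt
  · obtain ⟨p', q', h'⟩ := h.iteratedDeriv_combination n p q
    obtain ⟨D, hD⟩ := exists_norm_eval_le_exp_abs (Polynomial.X ^ k * p')
    obtain ⟨E, hE⟩ := exists_norm_eval_le_exp_abs (Polynomial.X ^ k * q')
    have hnonneg : ∀ {M : ℝ} {r : Polynomial ℂ},
        (∀ x : ℝ, ‖r.eval (x : ℂ)‖ ≤ M * Real.exp |x|) → 0 ≤ M := fun {M r} hM => by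
      simpa using (norm_nonneg _).trans (hM 0)
    refine ⟨D * C + E * C, fun x => ?_⟩
    rw [norm_iteratedFDeriv_eq_norm_iteratedDeriv, h']
    have hx : ‖x‖ ^ k = ‖(x : ℂ) ^ k‖ := by rw [norm_pow, Complex.norm_real]
    have key : ∀ {M : ℝ} {r : Polynomial ℂ} {z : ℂ}, 0 ≤ M →
        ‖(Polynomial.X ^ k * r).eval (x : ℂ)‖ ≤ M * Real.exp |x| → Real.exp |x| * ‖z‖ ≤ C →
        ‖(x : ℂ) ^ k * (r.eval (x : ℂ) * z)‖ ≤ M * C := fun {M r z} hM0 hM hz => by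
      rw [← mul_assoc, norm_mul]
      rw [Polynomial.eval_mul, Polynomial.eval_pow, Polynomial.eval_X] at hM
      calc _ ≤ M * Real.exp |x| * ‖z‖ := mul_le_mul_of_nonneg_right hM (norm_nonneg z)
        _ ≤ M * C := by rw [mul_assoc]; exact mul_le_mul_of_nonneg_left hz hM0
    rw [hx, ← norm_mul, mul_add]
    exact (norm_add_le _ _).trans (add_le_add (key (hnonneg hD) (hD x) (hC x).1)
      (key (hnonneg hE) (hE x) (hC x).2))

lemma IsSolution.isSchwartz {A B : Matrix (Fin 2) (Fin 2) ℂ} {f g : ℝ → ℂ}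
    (h : IsSolution A B f g) {C : ℝ}
    (hC : ∀ x, Real.exp |x| * ‖f x‖ ≤ C ∧ Real.exp |x| * ‖g x‖ ≤ C) :
    IsSchwartz f ∧ IsSchwartz g :=
  ⟨by simpa using h.isSchwartz_combination hC 1 0, by simpa using h.isSchwartz_combination hC 0 1⟩

/-! ### Diagonalization -/

/-- An arbitrary diagonalizing `P` may list the eigenvalues in either order. A nonzero coordinate of
`P w`, for an eigenvector `w`, identifies the entry. -/
lemma apply_eq_of_hasEigenvalue_of_isDiag {A : Matrix (Fin 2) (Fin 2) ℂ} {P : GL (Fin 2) ℂ}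
    (hD : (P.val * A * P⁻¹.val).IsDiag) {l : ℂ}
    (hA : Module.End.HasEigenvalue (Matrix.toLin' A) l) :
    (P.val * A * P⁻¹.val) 0 0 = l ∨ (P.val * A * P⁻¹.val) 1 1 = l := by
  obtain ⟨w, hw⟩ := hA.exists_hasEigenvector
  have hPP : P⁻¹.val * P.val = 1 := by rw [← Units.val_mul, inv_mul_cancel, Units.val_one]
  have hAw : A.mulVec w = l • w := by simpa using hw.apply_eq_smul
  set D := P.val * A * P⁻¹.val with hD_def
  have h1 : D.mulVec (P.val.mulVec w) = l • P.val.mulVec w := by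
    rw [Matrix.mulVec_mulVec, hD_def, mul_assoc, hPP, mul_one, ← Matrix.mulVec_mulVec, hAw,
      Matrix.mulVec_smul]
  have h2 : P.val.mulVec w ≠ 0 := fun h0 => hw.2 <| by
    rw [← Matrix.one_mulVec w, ← hPP, ← Matrix.mulVec_mulVec, h0, Matrix.mulVec_zero]
  have h3 := congrFun h1 0
  have h4 := congrFun h1 1
  simp only [Matrix.mulVec, dotProduct, Fin.sum_univ_two, Pi.smul_apply, smul_eq_mul,
    hD zero_ne_one, hD one_ne_zero, zero_mul, add_zero, zero_add] at h3 h4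
  by_contra! hne
  refine h2 (funext fun i => ?_)
  fin_cases i
  · have h5 := mul_right_cancel₀ (M₀ := ℂ) (b := (P.val.mulVec w) 0) (a := D 0 0) (c := l)
    by_contra h0
    refine hne.1 (h5 h0 ?_)
    simpa [Matrix.mulVec, dotProduct, Fin.sum_univ_two] using h3
  · have h5 := mul_right_cancel₀ (M₀ := ℂ) (b := (P.val.mulVec w) 1) (a := D 1 1) (c := l)
    by_contra h0
    refine hne.2 (h5 h0 ?_)
    simpa [Matrix.mulVec, dotProduct, Fin.sum_univ_two] using h4

/-- A vector that is an eigenvector of both conjugated matrices yields a common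
eigenvector. -/
lemma sharesEigenvector_of_conj {A B : Matrix (Fin 2) (Fin 2) ℂ} (P : GL (Fin 2) ℂ) {l m : ℂ}
    {e : Fin 2 → ℂ} (he : e ≠ 0) (hA : (P.val * A * P⁻¹.val).mulVec e = l • e)
    (hB : (P.val * B * P⁻¹.val).mulVec e = m • e) : SharesEigenvector A B l := by
  have hPP : P⁻¹.val * P.val = 1 := by rw [← Units.val_mul, inv_mul_cancel, Units.val_one]
  have hPP' : P.val * P⁻¹.val = 1 := by rw [← Units.val_mul, mul_inv_cancel, Units.val_one]
  have hne : P⁻¹.val.mulVec e ≠ 0 := fun h0 => he <| by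
    rw [← Matrix.one_mulVec e, ← hPP', ← Matrix.mulVec_mulVec, h0, Matrix.mulVec_zero]
  have key : ∀ (M : Matrix (Fin 2) (Fin 2) ℂ) (c : ℂ), (P.val * M * P⁻¹.val).mulVec e = c • e →
      Module.End.HasEigenvector (Matrix.toLin' M) c (P⁻¹.val.mulVec e) := fun M c hM => by
    refine Module.End.hasEigenvector_iff.2 ⟨Module.End.mem_eigenspace_iff.2 ?_, hne⟩
    rw [Matrix.toLin'_apply, ← Matrix.mulVec_smul, ← hM, Matrix.mulVec_mulVec,
      Matrix.mulVec_mulVec, ← mul_assoc, ← mul_assoc, hPP, one_mul]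
  exact ⟨P⁻¹.val.mulVec e, m, key A l hA, key B m hB⟩

lemma exists_conj_isDiag {A : Matrix (Fin 2) (Fin 2) ℂ} {l₁ l₂ : ℂ} (hl : l₁ ≠ l₂)
    (hA₁ : Module.End.HasEigenvalue (Matrix.toLin' A) l₁)
    (hA₂ : Module.End.HasEigenvalue (Matrix.toLin' A) l₂) :
    ∃ P : GL (Fin 2) ℂ, P.val * A * P⁻¹.val = Matrix.diagonal ![l₁, l₂] := by
  obtain ⟨v, hv⟩ := hA₁.exists_hasEigenvector
  obtain ⟨w, hw⟩ := hA₂.exists_hasEigenvector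
  have hAv : A.mulVec v = l₁ • v := by simpa using hv.apply_eq_smul
  have hAw : A.mulVec w = l₂ • w := by simpa using hw.apply_eq_smul
  have hli : LinearIndependent ℂ ![v, w] := by
    refine Module.End.eigenvectors_linearIndependent' (Matrix.toLin' A) ![l₁, l₂] ?_ _ ?_
    · intro i j
      fin_cases i <;> fin_cases j <;> simp [hl, hl.symm]
    · intro i
      fin_cases i
      · exact hv
      · exact hw
  -- The eigenvectors are the columns of `Q`, and the required `P` is `Q⁻¹`.
  set Q : Matrix (Fin 2) (Fin 2) ℂ := (Matrix.of ![v, w]).transpose with hQ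
  have hQu : IsUnit Q := by
    rw [hQ, Matrix.isUnit_transpose]
    exact Matrix.linearIndependent_rows_iff_isUnit.1 hli
  obtain ⟨R, hR⟩ := hQu
  refine ⟨R⁻¹, ?_⟩
  have h1 : A * Q = Q * Matrix.diagonal ![l₁, l₂] := by
    ext i j
    rw [Matrix.mul_diagonal]
    have hv' := congrFun hAv i
    have hw' := congrFun hAw i
    simp only [Matrix.mulVec, dotProduct, Pi.smul_apply, smul_eq_mul] at hv' hw'
    fin_cases j
    · simpa [Matrix.mul_apply, hQ, mul_comm] using hv'
    · simpa [Matrix.mul_apply, hQ, mul_comm] using hw'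
  have hRR : R⁻¹.val * R.val = 1 := by rw [← Units.val_mul, inv_mul_cancel, Units.val_one]
  rw [inv_inv, mul_assoc, hR, h1, ← hR, ← mul_assoc, hRR, one_mul]

/-! ### The three assertions -/

/-- On the line spanned by the common eigenvector the system is the scalar equation `E' = (lx +
m)E`, solved by a Gaussian. -/
lemma hasNonzeroL2Solution_of_sharesEigenvector {A B : Matrix (Fin 2) (Fin 2) ℂ} {l : ℝ}
    (hl : l < 0) (h : SharesEigenvector A B (l : ℂ)) : HasNonzeroL2Solution A B := by
  obtain ⟨v, m, hA, hB⟩ := h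
  have hAv : A.mulVec v = (l : ℂ) • v := by simpa using hA.apply_eq_smul
  have hBv : B.mulVec v = m • v := by simpa using hB.apply_eq_smul
  have hA0 := congrFun hAv 0
  have hA1 := congrFun hAv 1
  have hB0 := congrFun hBv 0
  have hB1 := congrFun hBv 1
  simp only [Matrix.mulVec, dotProduct, Fin.sum_univ_two, Pi.smul_apply, smul_eq_mul]
    at hA0 hA1 hB0 hB1
  set E : ℝ → ℂ := fun x => Complex.exp ((l : ℂ) * x ^ 2 / 2 + m * x) with hE
  have hEd : ∀ x, HasDerivAt E ((l * x + m) * E x) x := hasDerivAt_cexp_quadratic l m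
  have hEL : MemLp E 2 volume := by
    simpa using memLp_eval_mul_cexp_quadratic hl m 1
  refine ⟨fun x => v 0 * E x, fun x => v 1 * E x,
    ⟨isSolution_iff.2 fun x => ⟨?_, ?_⟩, hEL.const_mul _, hEL.const_mul _⟩, ?_⟩
  · refine ((hEd x).const_mul (v 0)).congr_deriv ?_
    linear_combination (-(x : ℂ) * E x) * hA0 - E x * hB0
  · refine ((hEd x).const_mul (v 1)).congr_deriv ?_
    linear_combination (-(x : ℂ) * E x) * hA1 - E x * hB1
  · by_contra! hz
    refine hA.2 (funext fun i => ?_)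
    have h0 := congrFun hz.1 0
    have h1 := congrFun hz.2 0
    fin_cases i
    · simpa [hE] using h0
    · simpa [hE] using h1

lemma hasNonzeroL2Solution_iff_of_isDiag {D B : Matrix (Fin 2) (Fin 2) ℂ} {l₁ l₂ : ℝ}
    (hl₁ : 0 < l₁) (hl₂ : l₂ < 0) (hD : D.IsDiag) (h₁ : D 0 0 = l₁) (h₂ : D 1 1 = l₂)
    (hB : B 0 1 ≠ 0) :
    HasNonzeroL2Solution D B ↔
      ∃ n : ℤ, n < 0 ∧ B 0 1 * B 1 0 = ((l₁ : ℂ) - (l₂ : ℂ)) * (n : ℂ) := by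
  constructor
  · rintro ⟨u, v, ⟨hs, hu, hv⟩, hne⟩
    by_contra hn
    obtain ⟨hu0, hv0⟩ := eq_zero_of_isDiagSolution hl₁ hB hn
      ((isSolution_iff_isDiagSolution hD h₁ h₂).1 hs) hu hv
    exact hne.elim (· hu0) (· hv0)
  · rintro ⟨n, hn, hb⟩
    obtain ⟨u, v, hs, hu, hv, hne⟩ :=
      exists_isDiagSolution_of_eq (b₁ := B 0 0) (b₄ := B 1 1) (hl₂.trans hl₁) hl₂ hn hb
    exact ⟨u, v, ⟨(isSolution_iff_isDiagSolution hD h₁ h₂).2 hs, hu, hv⟩, Or.inr hne⟩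

lemma hasNonzeroL2Solution_iff_of_not_sharesEigenvector {A B : Matrix (Fin 2) (Fin 2) ℂ}
    {l₁ l₂ : ℝ} (hl₁ : 0 < l₁) (hl₂ : l₂ < 0)
    (hA₁ : Module.End.HasEigenvalue (Matrix.toLin' A) (l₁ : ℂ))
    (hA₂ : Module.End.HasEigenvalue (Matrix.toLin' A) (l₂ : ℂ))
    (hS : ¬ SharesEigenvector A B (l₂ : ℂ)) (P : GL (Fin 2) ℂ)
    (hD : (P.val * A * P⁻¹.val).IsDiag) :
    HasNonzeroL2Solution A B ↔ ∃ n : ℤ, n < 0 ∧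
      (P.val * B * P⁻¹.val) 0 1 * (P.val * B * P⁻¹.val) 1 0 = ((l₁ : ℂ) - (l₂ : ℂ)) * (n : ℂ) := by
  have hl : (l₁ : ℂ) ≠ l₂ := by exact_mod_cast (hl₂.trans hl₁).ne'
  have hd₁ := apply_eq_of_hasEigenvalue_of_isDiag hD hA₁
  have hd₂ := apply_eq_of_hasEigenvalue_of_isDiag hD hA₂
  rw [← hasNonzeroL2Solution_conj_iff P]
  have hshare := fun (m : ℂ) (e : Fin 2 → ℂ) (he : e ≠ 0) hA hB =>
    hS (sharesEigenvector_of_conj (l := (l₂ : ℂ)) (m := m) P he hA hB)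
  set D := P.val * A * P⁻¹.val
  set B' := P.val * B * P⁻¹.val
  have h01 : D 0 1 = 0 := hD zero_ne_one
  have h10 : D 1 0 = 0 := hD one_ne_zero
  rcases hd₁ with h₁ | h₁
  · have h₂ : D 1 1 = l₂ := hd₂.resolve_left fun h => hl (h₁.symm.trans h)
    refine hasNonzeroL2Solution_iff_of_isDiag hl₁ hl₂ hD h₁ h₂ fun hb => ?_
    -- A zero upper right entry would make the second basis vector a common eigenvector.
    refine hshare (B' 1 1) ![0, 1] (by simp) ?_ ?_ <;> ext i <;> fin_cases i <;>
      simp [Matrix.mulVec, dotProduct, Fin.sum_univ_two, h01, h₂, hb]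
  · have h₂ : D 0 0 = l₂ := hd₂.resolve_right fun h => hl (h₁.symm.trans h)
    have hb : B' 1 0 ≠ 0 := fun hb => by
      refine hshare (B' 0 0) ![1, 0] (by simp) ?_ ?_ <;> ext i <;> fin_cases i <;>
        simp [Matrix.mulVec, dotProduct, Fin.sum_univ_two, h10, h₂, hb]
    -- With the eigenvalues in the opposite order, swapping the unknowns restores the normal form;
    -- the product of off-diagonal entries is symmetric.
    rw [← hasNonzeroL2Solution_swap_iff, mul_comm (B' 0 1)]
    exact hasNonzeroL2Solution_iff_of_isDiag
      (D := D.submatrix (Equiv.swap 0 1) (Equiv.swap 0 1))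
      (B := B'.submatrix (Equiv.swap 0 1) (Equiv.swap 0 1)) hl₁ hl₂
      (hD.submatrix (Equiv.injective _)) h₁ h₂ hb

lemma IsL2Solution.isSchwartz {A B : Matrix (Fin 2) (Fin 2) ℂ} {l₁ l₂ : ℝ} (hl₁ : 0 < l₁)
    (hl₂ : l₂ < 0) (hA₁ : Module.End.HasEigenvalue (Matrix.toLin' A) (l₁ : ℂ))
    (hA₂ : Module.End.HasEigenvalue (Matrix.toLin' A) (l₂ : ℂ)) {f g : ℝ → ℂ}
    (h : IsL2Solution A B f g) : IsSchwartz f ∧ IsSchwartz g := by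
  have hl : (l₁ : ℂ) ≠ l₂ := by exact_mod_cast (hl₂.trans hl₁).ne'
  obtain ⟨P, hP⟩ := exists_conj_isDiag hl hA₁ hA₂
  obtain ⟨hs, hu, -⟩ := h.conj P
  rw [hP] at hs
  have hs' := (isSolution_iff_isDiagSolution (l₁ := l₁) (l₂ := l₂) (Matrix.isDiag_diagonal _)
    (by simp) (by simp)).1 hs
  obtain ⟨C, hC⟩ := hs'.exists_exp_bound hl₁ hl₂ hu
  set Q := P⁻¹.val
  -- A crude bound on both rows of `P⁻¹`, used to carry the decay of `u`, `v` back to `f`, `g`.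
  set M : ℝ := ‖Q 0 0‖ + ‖Q 0 1‖ + ‖Q 1 0‖ + ‖Q 1 1‖ with hM
  have hC0 : 0 ≤ C := le_trans (by positivity) (hC 0).1
  have key : ∀ (x : ℝ) (a b u v : ℂ), ‖a‖ + ‖b‖ ≤ M → Real.exp |x| * ‖u‖ ≤ C →
      Real.exp |x| * ‖v‖ ≤ C → Real.exp |x| * ‖a * u + b * v‖ ≤ M * C := by
    intro x a b u v hab hu hv
    calc Real.exp |x| * ‖a * u + b * v‖ ≤ Real.exp |x| * (‖a‖ * ‖u‖ + ‖b‖ * ‖v‖) := by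
          gcongr
          simpa only [norm_mul] using norm_add_le (a * u) (b * v)
      _ = ‖a‖ * (Real.exp |x| * ‖u‖) + ‖b‖ * (Real.exp |x| * ‖v‖) := by ring
      _ ≤ ‖a‖ * C + ‖b‖ * C := by gcongr
      _ = (‖a‖ + ‖b‖) * C := by ring
      _ ≤ M * C := by gcongr
  have n1 := norm_nonneg (Q 0 0)
  have n2 := norm_nonneg (Q 0 1)
  have n3 := norm_nonneg (Q 1 0)
  have n4 := norm_nonneg (Q 1 1)
  refine h.1.isSchwartz (C := M * C) fun x => ?_
  obtain ⟨hf, hg⟩ := inv_apply_combination P (f x) (g x)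
  constructor
  · rw [← hf]
    exact key x _ _ _ _ (by linarith) (hC x).1 (hC x).2
  · rw [← hg]
    exact key x _ _ _ _ (by linarith) (hC x).1 (hC x).2

theorem theorem3p1 (A B : Matrix (Fin 2) (Fin 2) ℂ) (l₁ l₂ : ℝ) (hl₁ : 0 < l₁) (hl₂ : l₂ < 0)
    (hA₁ : Module.End.HasEigenvalue (Matrix.toLin' A) (l₁ : ℂ))
    (hA₂ : Module.End.HasEigenvalue (Matrix.toLin' A) (l₂ : ℂ)) :
    -- the criterion, for every diagonalizing `P`, outside the degenerate (triangular) case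
    (¬ SharesEigenvector A B (l₂ : ℂ) →
      ∀ P : GL (Fin 2) ℂ, (P.val * A * P⁻¹.val).IsDiag →
        (HasNonzeroL2Solution A B ↔
          ∃ n : ℤ, n < 0 ∧
            (P.val * B * P⁻¹.val) 0 1 * (P.val * B * P⁻¹.val) 1 0
              = ((l₁ : ℂ) - (l₂ : ℂ)) * (n : ℂ))) ∧
    -- in the degenerate case a nonzero square-integrable solution always exists
    (SharesEigenvector A B (l₂ : ℂ) → HasNonzeroL2Solution A B) ∧
    -- square-integrable solutions are Schwartz
    (∀ f g : ℝ → ℂ, IsL2Solution A B f g → IsSchwartz f ∧ IsSchwartz g) := by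
  exact ⟨hasNonzeroL2Solution_iff_of_not_sharesEigenvector hl₁ hl₂ hA₁ hA₂,
    hasNonzeroL2Solution_of_sharesEigenvector hl₂, fun _ _ h => h.isSchwartz hl₁ hl₂ hA₁ hA₂⟩
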